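/- For a positive integer $n$, let $X_n$ be the unitary Cayley graph of $\mathbb{Z}/n\mathbb{Z}$: its vertices are the elements of $\mathbb{Z}/n\mathbb{Z}$, and two distinct elements $x,y$ are adjacent if and only if $x-y$ is a unit. A dominating set of a finite graph is a set $D$ of vertices such that every vertex lies in $D$ or is adjacent to an element of $D$; $\gamma(G)$ denotes the minimum cardinality of a dominating set of $G$. Let $p_1<p_2<\cdots$ be the primes in increasing order. Then there exist absolute constants $C_1,C_2>0$ such that, for all sufficiently large $t$, the integer $n=p_1p_2\cdots p_t$ satisfies \[ C_1\, t\log t \;\le\; \gamma(X_n) \;\le\; C_2\, t\,(\log t)^2 . \] -/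

import Mathlib

/-- The unitary Cayley graph `X_R` of a commutative ring `R`: distinct elements `x`, `y` are adjacent
if and only if `x - y` is a unit. (In a nontrivial ring the condition `x ≠ y` is automatic; it only
rules out a loop over the zero ring.) -/
def unitaryCayleyGraph (R : Type*) [CommRing R] : SimpleGraph R where
  Adj x y := x ≠ y ∧ IsUnit (x - y)
  symm := ⟨fun x y h => ⟨h.1.symm, by simpa using h.2.neg⟩⟩
  loopless := ⟨fun _ h => h.1 rfl⟩

/-- The closed neighborhood `N[u]`: the neighbors of `u`, along with `u` itself. -/
def closedNeighborSet {V : Type*} (G : SimpleGraph V) (u : V) : Set V :=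
  insert u (G.neighborSet u)

/-- `D` is a dominating set of `G`: the closed neighborhoods of its elements cover all vertices. -/
def IsDominatingSet {V : Type*} (G : SimpleGraph V) (D : Set V) : Prop :=
  (⋃ u ∈ D, closedNeighborSet G u) = Set.univ

/-- The domination number `γ(G)` of a finite graph `G`: the minimum cardinality of a dominating set.
(The set of cardinalities is nonempty for a finite graph, since all vertices together dominate.) -/
noncomputable def dominationNumber {V : Type*} (G : SimpleGraph V) : ℕ :=
  sInf {k : ℕ | ∃ D : Finset V, IsDominatingSet G (D : Set V) ∧ D.card = k}

/-- The product `p_1 ⋯ p_t` of the first `t` primes; `Nat.nth Nat.Prime i` is the prime `p_{i+1}`. -/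
noncomputable def firstPrimesProduct (t : ℕ) : ℕ :=
  ∏ i ∈ Finset.range t, Nat.nth Nat.Prime i

/-!
Write `P(N) = ∏_{p < N} (1 - 1 / p)`, and let `n` be the product of the first `t` primes.

*Upper bound.* Each vertex of the unitary Cayley graph has `φ(n)` neighbours, so greedily choosing
the vertex that dominates most of what is left multiplies the number of undominated vertices by at
most `1 - φ(n) / n` each time. Hence `γ ≤ (n / φ(n)) log n + 1`
(`dominationNumber_unitaryCayleyGraph_le`). Here `log n = O(t log t)` because `p_t ≤ t ^ 3`
(`nth_prime_le_cube`), and `n / φ(n) = 1 / P(p_t + 1) = O(log t)` by the upper bound in Mertens'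
third theorem (`exists_prod_primesBelow_inv_le_mul_log`). The latter follows from a comparison of
the Euler product at `1` with the one at `1 + 1 / log N`, which is at most `ζ(1 + 1 / log N)`. The
error in the comparison is bounded by Mertens' first theorem.

*Lower bound.* If `D` dominates, then `E = D ∪ (D + 1)` has the property that every `x` differs from
some element of `E` by a unit. Such a set must be large: going through the first `t / 2` primes,
choose for each a residue class that contains at least the average number of the remaining elements
of `E`, so that at most `|E| P(p_{t/2} + 1)` elements survive. If there were at most `t / 2`
survivors, each could be given a residue class modulo a prime of its own among the remaining primes,
and the Chinese remainder theorem would yield an `x` for which `x - e` shares a prime factor with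
`n` for all `e ∈ E`. So `2γ ≥ |E| > (t / 2) / P(p_{t/2} + 1)`, and
`1 / P(N) ≥ ∑_{m < N} 1 / m ≥ log N` (`log_le_prod_primesBelow_inv`).
-/

/-! ### Mertens and Chebyshev bounds -/

open Finset in
/-- Mertens' first theorem, upper bound: compare `log N!` with the contribution
`⌊N / p⌋ * log p ≥ (N / p - 1) * log p` of each prime to it. -/
theorem sum_primesLE_log_div_le {N : ℕ} (hN : 0 < N) :
    ∑ p ∈ Nat.primesLE N, Real.log p / p ≤ Real.log N + Real.log 4 := by
  have hN' : (0 : ℝ) < N := by exact_mod_cast hN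
  have hfac : ∑ p ∈ Nat.primesLE N, ((N / p : ℕ) : ℝ) * Real.log p ≤ Real.log N.factorial := by
    rw [Real.log_nat_eq_sum_factorization, Finsupp.sum]
    refine (sum_le_sum fun p hp ↦ ?_).trans (sum_le_sum_of_subset_of_nonneg
      (f := fun p ↦ ((N.factorial.factorization p : ℕ) : ℝ) * Real.log p) ?_ ?_)
    · have hpp := Nat.prime_of_mem_primesLE hp
      refine mul_le_mul_of_nonneg_right ?_ (Real.log_natCast_nonneg p)
      have hpow : p ^ (N / p) ∣ N.factorial := by
        have hdvd : (p * (N / p)).factorial ∣ N.factorial :=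
          Nat.factorial_dvd_factorial (Nat.mul_div_le N p)
        rw [hpp.pow_dvd_iff_le_factorization N.factorial_ne_zero]
        refine le_trans ?_ ((Nat.factorization_le_iff_dvd (Nat.factorial_ne_zero _)
          N.factorial_ne_zero).2 hdvd p)
        rw [Nat.factorization_factorial_mul hpp]
        exact Nat.le_add_left _ _
      exact_mod_cast (hpp.pow_dvd_iff_le_factorization N.factorial_ne_zero).1 hpow
    · intro p hp
      have hpp := Nat.prime_of_mem_primesLE hp
      rw [Nat.support_factorization, Nat.mem_primeFactors]
      exact ⟨hpp, hpp.dvd_factorial.2 (Nat.le_of_mem_primesLE hp), N.factorial_ne_zero⟩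
    · intro p _ _
      have := Real.log_natCast_nonneg p
      positivity
  have hup : Real.log N.factorial ≤ N * Real.log N := by
    rw [← Real.log_pow]
    exact Real.log_le_log (by exact_mod_cast N.factorial_pos) (by exact_mod_cast N.factorial_le_pow)
  have htheta : ∑ p ∈ Nat.primesLE N, Real.log p ≤ Real.log 4 * N := by
    rw [← Chebyshev.theta_eq_sum_primesLE_log]
    exact Chebyshev.theta_le_log4_mul_x hN'.le
  have hterm : ∑ p ∈ Nat.primesLE N, (N * (Real.log p / p) - Real.log p) ≤
      ∑ p ∈ Nat.primesLE N, ((N / p : ℕ) : ℝ) * Real.log p := by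
    refine sum_le_sum fun p hp ↦ ?_
    have hpp := Nat.prime_of_mem_primesLE hp
    have hfl : (N : ℝ) / p - 1 ≤ ((N / p : ℕ) : ℝ) := by
      rw [← Nat.floor_div_eq_div (K := ℝ)]
      exact (Nat.sub_one_lt_floor _).le
    calc N * (Real.log p / p) - Real.log p = (N / p - 1) * Real.log p := by ring
      _ ≤ _ := mul_le_mul_of_nonneg_right hfl (Real.log_natCast_nonneg p)
  rw [sum_sub_distrib, ← mul_sum] at hterm
  have : (N : ℝ) * ∑ p ∈ Nat.primesLE N, Real.log p / p ≤ N * (Real.log N + Real.log 4) := by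
    linarith
  exact le_of_mul_le_mul_left this hN'

/-- The completely multiplicative function `n ↦ n ^ (-s)`. -/
noncomputable def rpowNegHom (s : ℝ) : ℕ →* ℝ where
  toFun n := (n : ℝ) ^ (-s)
  map_one' := by simp
  map_mul' m n := by push_cast; exact Real.mul_rpow m.cast_nonneg n.cast_nonneg

theorem norm_rpowNegHom_lt_one {s : ℝ} (hs : 0 < s) {p : ℕ} (hp : p.Prime) :
    ‖rpowNegHom s p‖ < 1 := by
  have h1 : (1 : ℝ) < p := by exact_mod_cast hp.one_lt
  change ‖(p : ℝ) ^ (-s)‖ < 1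
  rw [Real.norm_of_nonneg (by positivity)]
  exact Real.rpow_lt_one_of_one_lt_of_neg h1 (by linarith)

/-- Expanding the Euler product gives the sum of `1 / m` over `N`-smooth `m`, which exceeds the
harmonic sum over `m < N`. -/
theorem log_le_prod_primesBelow_inv {N : ℕ} (hN : 0 < N) :
    Real.log N ≤ (∏ p ∈ N.primesBelow, (1 - (p : ℝ)⁻¹))⁻¹ := by
  have h := EulerProduct.summable_and_hasSum_smoothNumbers_prod_primesBelow_geometric
    (f := rpowNegHom 1) (fun hp ↦ norm_rpowNegHom_lt_one one_pos hp) N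
  have hval (n : ℕ) : rpowNegHom 1 n = (n : ℝ)⁻¹ := Real.rpow_neg_one _
  simp only [hval, Finset.prod_inv_distrib] at h
  obtain ⟨M, rfl⟩ : ∃ M, N = M + 1 := ⟨N - 1, by omega⟩
  refine (log_add_one_le_harmonic M).trans ?_
  rw [harmonic_eq_sum_Icc]
  push_cast
  have hmem : ∀ i ∈ Finset.Icc 1 M, i ∈ (M + 1).smoothNumbers := fun i hi ↦ by
    rw [Finset.mem_Icc] at hi
    exact Nat.mem_smoothNumbers_of_lt (by omega) (by omega)
  have hsum : ∑ i ∈ Finset.Icc 1 M, (i : ℝ)⁻¹ =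
      ∑ i ∈ (Finset.Icc 1 M).subtype (· ∈ (M + 1).smoothNumbers), ((i : ℕ) : ℝ)⁻¹ :=
    (Finset.sum_subtype_of_mem (fun i : ℕ ↦ (i : ℝ)⁻¹) hmem).symm
  rw [hsum]
  exact sum_le_hasSum _ (fun i _ ↦ by positivity) h.2

open Finset in
/-- The Euler factor at `1` is at most `exp (2 * ε * log p / p)` times the one at `1 + ε`, and the
product of these errors over `p < N` is controlled by Mertens' first theorem. -/
theorem prod_primesBelow_inv_le_exp_mul_tsum {N : ℕ} (hN : 0 < N) {ε : ℝ} (hε : 0 < ε) :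
    (∏ p ∈ N.primesBelow, (1 - (p : ℝ)⁻¹))⁻¹ ≤
      Real.exp (2 * ε * (Real.log N + Real.log 4)) * ∑' n : ℕ, 1 / (n : ℝ) ^ (1 + ε) := by
  have hsummable : Summable (rpowNegHom (1 + ε)) :=
    (Real.summable_nat_rpow (p := -(1 + ε))).2 (by linarith)
  have hnonneg (n : ℕ) : 0 ≤ rpowNegHom (1 + ε) n := Real.rpow_nonneg n.cast_nonneg _
  have hone (p : ℕ) (hp : p.Prime) : rpowNegHom (1 + ε) p < 1 :=
    (Real.le_norm_self _).trans_lt (norm_rpowNegHom_lt_one (by linarith) hp)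
  have hzeta : (∏ p ∈ N.primesBelow, (1 - rpowNegHom (1 + ε) p))⁻¹ ≤
      ∑' n : ℕ, 1 / (n : ℝ) ^ (1 + ε) := by
    rw [← prod_inv_distrib, EulerProduct.prod_primesBelow_geometric_eq_tsum_smoothNumbers hsummable]
    refine (hsummable.tsum_subtype_le _ _ hnonneg).trans_eq (tsum_congr fun n ↦ ?_)
    rw [one_div, ← Real.rpow_neg n.cast_nonneg]
    rfl
  have hfactor : ∀ p ∈ N.primesBelow, (1 - (p : ℝ)⁻¹)⁻¹ ≤
      Real.exp (2 * ε * (Real.log p / p)) * (1 - rpowNegHom (1 + ε) p)⁻¹ := by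
    intro p hp
    have hpp := Nat.prime_of_mem_primesBelow hp
    have h2 : (2 : ℝ) ≤ p := by exact_mod_cast hpp.two_le
    have hp0 : (0 : ℝ) < p := by linarith
    have hinv : (p : ℝ)⁻¹ ≤ 1 / 2 := by rw [inv_le_comm₀ hp0 (by norm_num)]; linarith
    have hu : 0 ≤ ε * (Real.log p / p) := by
      have := Real.log_natCast_nonneg p
      positivity
    -- By convexity of `exp`, `p ^ (-ε) ≥ 1 - ε * log p`
    have hpow : (p : ℝ)⁻¹ - ε * (Real.log p / p) ≤ rpowNegHom (1 + ε) p := by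
      change _ ≤ (p : ℝ) ^ (-(1 + ε))
      rw [neg_add, Real.rpow_add hp0, Real.rpow_neg_one, Real.rpow_def_of_pos hp0]
      calc (p : ℝ)⁻¹ - ε * (Real.log p / p) = (p : ℝ)⁻¹ * (Real.log p * -ε + 1) := by
            field_simp; ring
        _ ≤ _ := mul_le_mul_of_nonneg_left (Real.add_one_le_exp _) (by positivity)
    have hexp := Real.add_one_le_exp (2 * ε * (Real.log p / p))
    have hlt := hone p hpp
    rw [← div_eq_mul_inv, le_div_iff₀ (by linarith), inv_mul_le_iff₀ (by linarith)]
    calc 1 - rpowNegHom (1 + ε) p ≤ (1 - (p : ℝ)⁻¹) * (2 * ε * (Real.log p / p) + 1) := by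
          nlinarith
      _ ≤ _ := mul_le_mul_of_nonneg_left hexp (by linarith)
  have hprod := prod_le_prod (fun p hp ↦ ?_) hfactor
  · rw [prod_mul_distrib, prod_inv_distrib, prod_inv_distrib, ← Real.exp_sum, ← mul_sum] at hprod
    refine hprod.trans (mul_le_mul (Real.exp_le_exp.2 ?_) hzeta ?_ (Real.exp_nonneg _))
    · refine mul_le_mul_of_nonneg_left (le_trans ?_ (sum_primesLE_log_div_le hN)) (by positivity)
      refine sum_le_sum_of_subset_of_nonneg (Nat.primesBelow_mono (Nat.le_succ N)) fun p _ _ ↦ ?_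
      have := Real.log_natCast_nonneg p
      positivity
    · refine inv_nonneg.2 (prod_nonneg fun p hp ↦ ?_)
      linarith [hone p (Nat.prime_of_mem_primesBelow hp)]
  · have h2 : (1 : ℝ) ≤ p := by exact_mod_cast (Nat.prime_of_mem_primesBelow hp).one_le
    exact inv_nonneg.2 (sub_nonneg.2 (inv_le_one_of_one_le₀ h2))

open Filter Topology in
/-- Mertens' third theorem, upper bound up to a constant: take `ε = 1 / log N`, where
`ζ (1 + ε) ≤ 2 / ε`. -/
theorem exists_prod_primesBelow_inv_le_mul_log :
    ∃ C : ℝ, 0 < C ∧ ∀ᶠ N : ℕ in atTop,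
      (∏ p ∈ N.primesBelow, (1 - (p : ℝ)⁻¹))⁻¹ ≤ C * Real.log N := by
  refine ⟨Real.exp (2 * (1 + Real.log 4)) * 2, by positivity, ?_⟩
  have hlog : Tendsto (fun N : ℕ ↦ Real.log N) atTop atTop :=
    Real.tendsto_log_atTop.comp tendsto_natCast_atTop_atTop
  have hs : Tendsto (fun N : ℕ ↦ 1 + (Real.log N)⁻¹) atTop (𝓝[>] 1) := by
    refine tendsto_nhdsWithin_iff.2 ⟨by simpa using hlog.inv_tendsto_atTop.const_add 1, ?_⟩
    filter_upwards [hlog.eventually_gt_atTop 0] with N hN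
    simpa using hN
  have hz :=
    (tendsto_sub_mul_tsum_nat_rpow.comp hs).eventually_le_const (show (1 : ℝ) < 2 by norm_num)
  filter_upwards [hz, hlog.eventually_ge_atTop 1, eventually_gt_atTop 0] with N hzN hN hN0
  have hl0 : 0 < Real.log N := by linarith
  simp only [Function.comp_apply, add_sub_cancel_left] at hzN
  rw [inv_mul_le_iff₀ hl0] at hzN
  refine (prod_primesBelow_inv_le_exp_mul_tsum hN0 (inv_pos.2 hl0)).trans ?_
  rw [mul_assoc (Real.exp (2 * (1 + Real.log 4))), mul_comm 2 (Real.log N)]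
  refine mul_le_mul (Real.exp_le_exp.2 ?_) hzN (tsum_nonneg fun n ↦ by positivity)
    (Real.exp_nonneg _)
  have h4 : 0 ≤ Real.log 4 := Real.log_nonneg (by norm_num)
  have : (Real.log N)⁻¹ ≤ 1 := inv_le_one_of_one_le₀ hN
  calc 2 * (Real.log N)⁻¹ * (Real.log N + Real.log 4)
      = 2 * (1 + (Real.log N)⁻¹ * Real.log 4) := by field_simp
    _ ≤ _ := by nlinarith

/-- A crude consequence of Chebyshev's lower bound for `π`; only `log p_t = O(log t)` matters. -/
theorem nth_prime_le_cube {t : ℕ} (ht : 6 ≤ t) : Nat.nth Nat.Prime t ≤ t ^ 3 := by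
  have htr : (6 : ℝ) ≤ t := by exact_mod_cast ht
  have hlogt : Real.log t ≤ t - 1 := Real.log_le_sub_one_of_pos (by linarith)
  have hlog0 : 0 < Real.log t := Real.log_pos (by linarith)
  have h := Chebyshev.pi_ge (t ^ 3)
  push_cast at h
  rw [Real.log_pow, div_le_iff₀ (by push_cast; positivity)] at h
  have hsucc : Real.log ((t : ℝ) ^ 3 + 1) ≤ 3 * t := by
    have : Real.log ((t : ℝ) ^ 3 + 1) ≤ Real.log (2 * (t : ℝ) ^ 3) :=
      Real.log_le_log (by positivity) (by
        nlinarith [one_le_pow₀ (n := 3) (show (1 : ℝ) ≤ t by linarith)])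
    rw [Real.log_mul (by norm_num) (by positivity), Real.log_pow] at this
    push_cast at this
    linarith [Real.log_two_lt_d9]
  have hlt : (t : ℝ) < Nat.primeCounting (t ^ 3) := by
    by_contra hcon
    rw [not_lt] at hcon
    have h1 : (Nat.primeCounting (t ^ 3) : ℝ) * (((3 : ℕ) : ℝ) * Real.log t) ≤
        t * (3 * (t - 1)) := by
      push_cast
      gcongr
    have h2 : (t : ℝ) ^ 3 * 0.6 ≤ (t : ℝ) ^ 3 * Real.log 2 := by
      gcongr
      linarith [Real.log_two_gt_d9]
    nlinarith [sq_nonneg (t : ℝ), mul_nonneg (sq_nonneg (t : ℝ)) (sub_nonneg.2 htr)]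
  exact Nat.lt_succ_iff.1 (Nat.nth_lt_of_lt_count (by exact_mod_cast hlt))

theorem card_primesBelow_nth_prime (t : ℕ) : (Nat.nth Nat.Prime t).primesBelow.card = t := by
  rw [Nat.primesBelow_card_eq_primeCounting', Nat.primeCounting'_nth_eq]

theorem firstPrimesProduct_eq_prod_primesBelow (t : ℕ) :
    firstPrimesProduct t = ∏ p ∈ (Nat.nth Nat.Prime t).primesBelow, p := by
  have hmono := Nat.nth_strictMono Nat.infinite_setOfPred_prime
  refine Finset.prod_bij (fun i _ ↦ Nat.nth Nat.Prime i) (fun i hi ↦ ?_)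
    (fun i _ j _ h ↦ hmono.injective h) (fun p hp ↦ ?_) (fun _ _ ↦ rfl)
  · exact Nat.mem_primesBelow.2 ⟨hmono (Finset.mem_range.1 hi), Nat.prime_nth_prime i⟩
  · obtain ⟨hlt, hpp⟩ := Nat.mem_primesBelow.1 hp
    have hnth := Nat.nth_count hpp
    refine ⟨Nat.count Nat.Prime p, Finset.mem_range.2 (hmono.lt_iff_lt.1 ?_), hnth⟩
    rwa [hnth]

theorem totient_prod_primes {S : Finset ℕ} (hS : ∀ p ∈ S, p.Prime) :
    ((∏ p ∈ S, p).totient : ℝ) = (∏ p ∈ S, p : ℕ) * ∏ p ∈ S, (1 - (p : ℝ)⁻¹) := by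
  have h := Nat.totient_eq_mul_prod_factors (∏ p ∈ S, p)
  rw [Nat.primeFactors_prod hS] at h
  have h' := congrArg (Rat.cast (K := ℝ)) h
  push_cast at h' ⊢
  exact h'

/-! ### Dominating sets by greedy covering -/

open Finset in
/-- Greedy covering: averaging over `d` finds an element that covers at least the fraction
`r / |V|` of what is still uncovered. -/
theorem exists_finset_card_uncovered_le {V : Type*} [Fintype V] [DecidableEq V] [Nonempty V]
    (cov : V → V → Prop) [DecidableRel cov] {r : ℕ} (hr : ∀ x, r ≤ #{d | cov d x}) (k : ℕ) :
    ∃ D : Finset V, #D ≤ k ∧ (#{x | ∀ d ∈ D, ¬ cov d x} : ℝ) ≤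
      Fintype.card V * (1 - (r : ℝ) / Fintype.card V) ^ k := by
  have hV : (0 : ℝ) < Fintype.card V := by exact_mod_cast Fintype.card_pos
  induction k with
  | zero => exact ⟨∅, by simp⟩
  | succ k ih =>
    obtain ⟨D, hDk, hD⟩ := ih
    set U : Finset V := {x | ∀ d ∈ D, ¬ cov d x} with hU
    obtain ⟨e, -, he⟩ : ∃ e ∈ (univ : Finset V),
        (r : ℝ) * #U / Fintype.card V ≤ #{x ∈ U | cov e x} := by
      refine exists_le_of_sum_le univ_nonempty ?_
      rw [sum_const, card_univ, nsmul_eq_mul, mul_div_cancel₀ _ hV.ne']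
      have hdc := sum_card_bipartiteAbove_eq_sum_card_bipartiteBelow (s := univ) (t := U) cov
      simp only [bipartiteAbove, bipartiteBelow] at hdc
      have hle : #U * r ≤ ∑ d, #{x ∈ U | cov d x} := by
        rw [hdc, ← smul_eq_mul, ← sum_const]
        exact sum_le_sum fun x _ ↦ hr x
      rw [mul_comm]
      exact_mod_cast hle
    have hr1 : (r : ℝ) / Fintype.card V ≤ 1 := by
      rw [div_le_one hV]
      exact_mod_cast (hr (Classical.arbitrary V)).trans (card_le_univ _)
    refine ⟨insert e D, (card_insert_le _ _).trans (by omega), ?_⟩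
    have hsplit : #{x | ∀ d ∈ insert e D, ¬ cov d x} + #{x ∈ U | cov e x} = #U := by
      rw [← card_filter_add_card_filter_not (s := U) (cov e), add_comm]
      congr 2
      ext x
      simp [hU, and_comm]
    have hsplit' : (#{x | ∀ d ∈ insert e D, ¬ cov d x} : ℝ) + #{x ∈ U | cov e x} = #U := by
      exact_mod_cast hsplit
    calc (#{x | ∀ d ∈ insert e D, ¬ cov d x} : ℝ)
        ≤ (1 - (r : ℝ) / Fintype.card V) * #U := by
          have : (r : ℝ) * #U / Fintype.card V = r / Fintype.card V * #U := by ring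
          linarith
      _ ≤ (1 - (r : ℝ) / Fintype.card V) *
            (Fintype.card V * (1 - (r : ℝ) / Fintype.card V) ^ k) :=
          mul_le_mul_of_nonneg_left hD (by linarith)
      _ = _ := by ring

theorem isDominatingSet_iff {V : Type*} {G : SimpleGraph V} {D : Set V} :
    IsDominatingSet G D ↔ ∀ x, ∃ d ∈ D, x = d ∨ G.Adj d x := by
  simp [IsDominatingSet, closedNeighborSet, Set.eq_univ_iff_forall]

theorem dominationNumber_le_card {V : Type*} {G : SimpleGraph V} {D : Finset V}
    (hD : IsDominatingSet G (D : Set V)) : dominationNumber G ≤ D.card :=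
  Nat.sInf_le ⟨D, hD, rfl⟩

theorem exists_isDominatingSet_card_eq {V : Type*} [Fintype V] (G : SimpleGraph V) :
    ∃ D : Finset V, IsDominatingSet G (D : Set V) ∧ D.card = dominationNumber G :=
  Nat.sInf_mem (s := {k : ℕ | ∃ D : Finset V, IsDominatingSet G (D : Set V) ∧ D.card = k})
    ⟨_, Finset.univ, isDominatingSet_iff.2 fun x ↦ ⟨x, by simp⟩, rfl⟩

open Finset in
/-- Every vertex is dominated by at least `φ(n)` vertices, so greedy covering leaves at most
`n * (1 - φ(n) / n) ^ k ≤ n * exp (-k * φ(n) / n)` vertices uncovered after `k` steps, which is less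
than `1` as soon as `k > (n / φ(n)) * log n`. -/
theorem dominationNumber_unitaryCayleyGraph_le {n : ℕ} (hn : 1 < n) :
    (dominationNumber (unitaryCayleyGraph (ZMod n)) : ℝ) ≤
      n / n.totient * Real.log n + 1 := by
  classical
  have : NeZero n := ⟨by omega⟩
  have : Fact (1 < n) := ⟨hn⟩
  have hn0 : (0 : ℝ) < n := by exact_mod_cast (by omega : 0 < n)
  have hφ : (0 : ℝ) < n.totient := by exact_mod_cast Nat.totient_pos.2 (by omega)
  have hlog : 0 ≤ Real.log n := Real.log_natCast_nonneg n
  have hr (x : ZMod n) : n.totient ≤ #{d : ZMod n | IsUnit (d - x)} := by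
    rw [← ZMod.card_units_eq_totient, ← card_univ]
    refine card_le_card_of_injOn (fun u ↦ (u : ZMod n) + x) (fun u _ ↦ ?_) fun u _ v _ huv ↦ ?_
    · simp
    · exact Units.ext (add_right_cancel huv)
  set k : ℕ := ⌊n / n.totient * Real.log n⌋₊ + 1 with hk
  obtain ⟨D, hDk, hD⟩ := exists_finset_card_uncovered_le (fun d x : ZMod n ↦ IsUnit (d - x)) hr k
  rw [ZMod.card] at hD
  have hlt : (n : ℝ) * (1 - (n.totient : ℝ) / n) ^ k < 1 := by
    have hkgt : n / n.totient * Real.log n < k := by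
      rw [hk]; push_cast; exact Nat.lt_floor_add_one _
    have hle1 : (n.totient : ℝ) / n ≤ 1 := by
      rw [div_le_one hn0]; exact_mod_cast n.totient_le
    calc (n : ℝ) * (1 - (n.totient : ℝ) / n) ^ k
        ≤ n * Real.exp (-(n.totient / n)) ^ k := by
          gcongr
          exact Real.one_sub_le_exp_neg _
      _ = Real.exp (Real.log n - k * (n.totient / n)) := by
          rw [← Real.exp_nat_mul, Real.exp_sub, Real.exp_log hn0, mul_neg, Real.exp_neg]
          rfl
      _ < 1 := by
          rw [Real.exp_lt_one_iff, sub_neg, ← div_lt_iff₀ (by positivity)]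
          calc Real.log n / (n.totient / n) = n / n.totient * Real.log n := by field_simp
            _ < k := hkgt
  have hempty : #{x : ZMod n | ∀ d ∈ D, ¬ IsUnit (d - x)} = 0 := by
    have := hD.trans_lt hlt
    exact Nat.lt_one_iff.1 (by exact_mod_cast this)
  have hdom : IsDominatingSet (unitaryCayleyGraph (ZMod n)) (D : Set (ZMod n)) := by
    refine isDominatingSet_iff.2 fun x ↦ ?_
    have hx : x ∉ ({x : ZMod n | ∀ d ∈ D, ¬ IsUnit (d - x)} : Finset (ZMod n)) := by
      rw [card_eq_zero.1 hempty]; simp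
    simp only [mem_filter, mem_univ, true_and, not_forall, not_not] at hx
    obtain ⟨d, hd, hu⟩ := hx
    refine ⟨d, hd, Or.inr ⟨fun h ↦ ?_, hu⟩⟩
    rw [h, sub_self] at hu
    exact not_isUnit_zero hu
  calc (dominationNumber (unitaryCayleyGraph (ZMod n)) : ℝ) ≤ (k : ℕ) := by
        exact_mod_cast (dominationNumber_le_card hdom).trans hDk
    _ ≤ _ := by
        rw [hk]; push_cast
        gcongr
        exact Nat.floor_le (by positivity)

/-! ### Lower bound by sieving -/

open Finset in
/-- Greedy sieve: for each modulus in turn, remove the most popular residue class. -/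
theorem exists_residues_card_survivors_le (T S : Finset ℕ) (hS : ∀ p ∈ S, 0 < p) :
    ∃ a : ℕ → ℕ, (#{d ∈ T | ∀ p ∈ S, ¬ a p ≡ d [MOD p]} : ℝ) ≤
      #T * ∏ p ∈ S, (1 - (p : ℝ)⁻¹) := by
  induction S using Finset.induction with
  | empty => exact ⟨id, by simp⟩
  | insert q S hq ih =>
    obtain ⟨a, ha⟩ := ih fun p hp ↦ hS p (mem_insert_of_mem hp)
    have hq0 : 0 < q := hS q (mem_insert_self q S)
    have hqr : (1 : ℝ) ≤ q := by exact_mod_cast hq0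
    set L : Finset ℕ := {d ∈ T | ∀ p ∈ S, ¬ a p ≡ d [MOD p]} with hL
    obtain ⟨b, -, hb⟩ : ∃ b ∈ range q, (#L : ℝ) / q ≤ #{d ∈ L | d % q = b} := by
      refine exists_le_of_sum_le (nonempty_range_iff.2 hq0.ne') ?_
      rw [sum_const, card_range, nsmul_eq_mul, mul_div_cancel₀ _ (by positivity),
        card_eq_sum_card_fiberwise (f := (· % q)) (t := range q)
          fun d _ ↦ by simpa using Nat.mod_lt d hq0]
      push_cast
      rfl
    refine ⟨Function.update a q b, ?_⟩
    have hsub : ({d ∈ T | ∀ p ∈ insert q S, ¬ Function.update a q b p ≡ d [MOD p]} : Finset ℕ) ⊆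
        {d ∈ L | ¬ d % q = b} := by
      intro d hd
      simp only [mem_filter, forall_mem_insert, Function.update_self] at hd
      simp only [hL, mem_filter]
      refine ⟨⟨hd.1, fun p hp ↦ ?_⟩, fun h ↦ hd.2.1 ?_⟩
      · have hpq : p ≠ q := fun h ↦ hq (h ▸ hp)
        simpa [Function.update_of_ne hpq] using hd.2.2 p hp
      · rw [← h]; exact Nat.mod_modEq d q
    have hsplit : (#{d ∈ L | d % q = b} : ℝ) + #{d ∈ L | ¬ d % q = b} = #L := by
      exact_mod_cast card_filter_add_card_filter_not (s := L) (· % q = b)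
    have hinv : (q : ℝ)⁻¹ ≤ 1 := inv_le_one_of_one_le₀ hqr
    calc (#{d ∈ T | ∀ p ∈ insert q S, ¬ Function.update a q b p ≡ d [MOD p]} : ℝ)
        ≤ #{d ∈ L | ¬ d % q = b} := by exact_mod_cast card_le_card hsub
      _ ≤ (1 - (q : ℝ)⁻¹) * #L := by rw [div_eq_mul_inv] at hb; linarith
      _ ≤ (1 - (q : ℝ)⁻¹) * (#T * ∏ p ∈ S, (1 - (p : ℝ)⁻¹)) :=
          mul_le_mul_of_nonneg_left ha (by linarith)
      _ = _ := by rw [prod_insert hq]; ring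

open Finset in
/-- The primes in `S` sieve `T` down to at most `#S'` elements, each of which gets a prime of `S'`
of its own; the Chinese remainder theorem merges the congruences. -/
theorem exists_forall_modEq_of_card_mul_prod_le {T S S' : Finset ℕ} (hdisj : Disjoint S S')
    (hS : ∀ p ∈ S ∪ S', p.Prime) (hcard : #T * ∏ p ∈ S, (1 - (p : ℝ)⁻¹) ≤ #S') :
    ∃ x : ℕ, ∀ d ∈ T, ∃ p ∈ S ∪ S', x ≡ d [MOD p] := by
  classical
  obtain ⟨a, ha⟩ := exists_residues_card_survivors_le T S
    fun p hp ↦ (hS p (mem_union_left _ hp)).pos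
  set L : Finset ℕ := {d ∈ T | ∀ p ∈ S, ¬ a p ≡ d [MOD p]} with hL
  have hLS : #L ≤ #S' := by exact_mod_cast ha.trans hcard
  obtain ⟨e⟩ : Nonempty (L ↪ S') := Function.Embedding.nonempty_of_card_le (by simpa using hLS)
  let b : ℕ → ℕ := Function.extend (fun d : L ↦ (e d : ℕ)) (fun d ↦ (d : ℕ)) a
  have hb (d : L) : b (e d) = d :=
    (Subtype.val_injective.comp e.injective).extend_apply _ _ d
  obtain ⟨x, hx⟩ := Nat.chineseRemainderOfFinset (fun p ↦ if p ∈ S then a p else b p) id (S ∪ S')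
    (fun p hp ↦ (hS p hp).ne_zero)
    fun p hp q hq hpq ↦ (Nat.coprime_primes (hS p hp) (hS q hq)).2 hpq
  refine ⟨x, fun d hd ↦ ?_⟩
  by_cases hdL : d ∈ L
  · have hmem : (e ⟨d, hdL⟩ : ℕ) ∈ S' := (e ⟨d, hdL⟩).2
    refine ⟨_, mem_union_right _ hmem, ?_⟩
    simpa [disjoint_right.1 hdisj hmem, hb ⟨d, hdL⟩] using hx _ (mem_union_right _ hmem)
  · simp only [hL, mem_filter, not_and, not_forall, not_not] at hdL
    obtain ⟨p, hp, hpd⟩ := hdL hd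
    refine ⟨p, mem_union_left _ hp, Nat.ModEq.trans ?_ hpd⟩
    simpa [hp] using hx p (mem_union_left _ hp)

open Finset in
/-- If `D` dominates, then every vertex, including those of `D`, differs by a unit from some
element of `D ∪ (D + 1)`. If the asserted inequality failed, the sieve would produce a vertex whose
difference with each element of `D ∪ (D + 1)` is divisible by one of the primes. -/
theorem card_lt_two_mul_dominationNumber_mul_prod {S S' : Finset ℕ} (hdisj : Disjoint S S')
    (hS : ∀ p ∈ S ∪ S', p.Prime) :
    (#S' : ℝ) < 2 * dominationNumber (unitaryCayleyGraph (ZMod (∏ p ∈ S ∪ S', p))) *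
      ∏ p ∈ S, (1 - (p : ℝ)⁻¹) := by
  classical
  set n := ∏ p ∈ S ∪ S', p with hn
  have : NeZero n := ⟨prod_ne_zero_iff.2 fun p hp ↦ (hS p hp).ne_zero⟩
  obtain ⟨D, hD, hDcard⟩ := exists_isDominatingSet_card_eq (unitaryCayleyGraph (ZMod n))
  rw [isDominatingSet_iff] at hD
  rw [← hDcard]
  -- `x + 1` is adjacent to `x`, so the shift takes care of vertices dominated only by themselves.
  let E : Finset (ZMod n) := D ∪ D.image (· + 1)
  have hE (x : ZMod n) : ∃ d ∈ E, IsUnit (x - d) := by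
    obtain ⟨d, hd, rfl | hadj⟩ := hD x
    · exact ⟨x + 1, mem_union_right _ (mem_image_of_mem _ hd), by simp⟩
    · exact ⟨d, mem_union_left _ hd, by simpa using hadj.2.neg⟩
  have hEcard : #(E.image ZMod.val) ≤ 2 * #D := by
    have h1 : #E ≤ #D + #(D.image (· + 1)) := card_union_le _ _
    have h2 : #(D.image (· + 1)) ≤ #D := card_image_le
    have h3 : #(E.image ZMod.val) ≤ #E := card_image_le
    omega
  by_contra! hle
  have hprod : 0 ≤ ∏ p ∈ S, (1 - (p : ℝ)⁻¹) := prod_nonneg fun p hp ↦ by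
    have : (1 : ℝ) ≤ p := by exact_mod_cast (hS p (mem_union_left _ hp)).one_le
    exact sub_nonneg.2 (inv_le_one_of_one_le₀ this)
  obtain ⟨x, hx⟩ := exists_forall_modEq_of_card_mul_prod_le (T := E.image ZMod.val) hdisj hS
    ((mul_le_mul_of_nonneg_right (by exact_mod_cast hEcard) hprod).trans hle)
  obtain ⟨d, hd, hu⟩ := hE x
  obtain ⟨p, hp, hxd⟩ := hx d.val (mem_image_of_mem _ hd)
  have : Fact p.Prime := ⟨hS p hp⟩
  have hu' := hu.map (ZMod.castHom (dvd_prod_of_mem (fun p ↦ p) hp : p ∣ n) (ZMod p))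
  rw [← ZMod.natCast_zmod_val d, map_sub, map_natCast, map_natCast,
    (ZMod.natCast_eq_natCast_iff _ _ _).2 hxd, sub_self] at hu'
  exact not_isUnit_zero hu'

/-! ### Bounds for the product of the first primes -/

open Finset in
/-- The smaller half of the primes is used for sieving, the larger half for the survivors. -/
theorem mul_log_le_dominationNumber {t : ℕ} (ht : 4 ≤ t) :
    1 / 8 * (t : ℝ) * Real.log t ≤
      dominationNumber (unitaryCayleyGraph (ZMod (firstPrimesProduct t))) := by
  have htr : (4 : ℝ) ≤ t := by exact_mod_cast ht
  have hmono := Nat.nth_monotone Nat.infinite_setOfPred_prime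
  set N := Nat.nth Nat.Prime (t / 2) with hN
  have hNt : t / 2 + 2 ≤ N := Nat.add_two_le_nth_prime (t / 2)
  have hsub : N.primesBelow ⊆ (Nat.nth Nat.Prime t).primesBelow :=
    Nat.primesBelow_mono (hmono (Nat.div_le_self t 2))
  have hunion : N.primesBelow ∪ ((Nat.nth Nat.Prime t).primesBelow \ N.primesBelow) =
      (Nat.nth Nat.Prime t).primesBelow := union_sdiff_of_subset hsub
  have h := card_lt_two_mul_dominationNumber_mul_prod
    (S := N.primesBelow) (S' := (Nat.nth Nat.Prime t).primesBelow \ N.primesBelow)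
    disjoint_sdiff fun p hp ↦ Nat.prime_of_mem_primesBelow (hunion ▸ hp)
  rw [hunion, ← firstPrimesProduct_eq_prod_primesBelow, card_sdiff_of_subset hsub,
    card_primesBelow_nth_prime, card_primesBelow_nth_prime] at h
  set γ := dominationNumber (unitaryCayleyGraph (ZMod (firstPrimesProduct t)))
  have hP : 0 < ∏ p ∈ N.primesBelow, (1 - (p : ℝ)⁻¹) := prod_pos fun p hp ↦ by
    have : (1 : ℝ) < p := by exact_mod_cast (Nat.prime_of_mem_primesBelow hp).one_lt
    exact sub_pos.2 (inv_lt_one_of_one_lt₀ this)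
  have hlog := log_le_prod_primesBelow_inv (show 0 < N by omega)
  have hhalf : (t : ℝ) / 2 ≤ (t - t / 2 : ℕ) := by
    rw [div_le_iff₀ two_pos]; exact_mod_cast (by omega : t ≤ (t - t / 2) * 2)
  have hlogN : Real.log t / 2 ≤ Real.log N := by
    have h2N : (t : ℝ) ≤ 2 * N := by exact_mod_cast (by omega : t ≤ 2 * N)
    have hsq : (t : ℝ) ≤ (N : ℝ) ^ 2 := by nlinarith
    have := Real.log_le_log (by linarith) hsq
    rw [Real.log_pow] at this
    push_cast at this
    linarith
  have hlt0 : 0 ≤ Real.log t := Real.log_natCast_nonneg t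
  rw [← div_lt_iff₀ hP, div_eq_mul_inv] at h
  have : (t : ℝ) / 2 * (Real.log t / 2) ≤ 2 * γ :=
    (mul_le_mul hhalf (hlogN.trans hlog) (by positivity) (by positivity)).trans h.le
  linarith

theorem firstPrimesProduct_pos (t : ℕ) : 0 < firstPrimesProduct t :=
  Finset.prod_pos fun i _ ↦ (Nat.prime_nth_prime i).pos

theorem log_firstPrimesProduct_le {t : ℕ} (ht : 6 ≤ t) :
    Real.log (firstPrimesProduct t) ≤ 3 * t * Real.log t := by
  have hle : firstPrimesProduct t ≤ (t ^ 3) ^ t := by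
    rw [firstPrimesProduct_eq_prod_primesBelow]
    refine (Finset.prod_le_pow_card _ _ (t ^ 3) fun p hp ↦ ?_).trans_eq
      (by rw [card_primesBelow_nth_prime])
    exact (Nat.lt_of_mem_primesBelow hp).le.trans (nth_prime_le_cube ht)
  calc Real.log (firstPrimesProduct t) ≤ Real.log (((t : ℝ) ^ 3) ^ t) :=
        Real.log_le_log (by exact_mod_cast firstPrimesProduct_pos t) (by exact_mod_cast hle)
    _ = _ := by rw [Real.log_pow, Real.log_pow]; push_cast; ring

open Filter in
theorem exists_dominationNumber_le_mul_log_sq :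
    ∃ C : ℝ, 0 < C ∧ ∀ᶠ t : ℕ in atTop,
      (dominationNumber (unitaryCayleyGraph (ZMod (firstPrimesProduct t))) : ℝ) ≤
        C * (t : ℝ) * Real.log t ^ 2 := by
  obtain ⟨C, hC, hmertens⟩ := exists_prod_primesBelow_inv_le_mul_log
  refine ⟨9 * C + 1, by positivity, ?_⟩
  have hnth : Tendsto (Nat.nth Nat.Prime) atTop atTop :=
    (Nat.nth_strictMono Nat.infinite_setOfPred_prime).tendsto_atTop
  filter_upwards [hnth.eventually hmertens, eventually_ge_atTop 6] with t hP ht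
  have htr : (6 : ℝ) ≤ t := by exact_mod_cast ht
  have hprime (p : ℕ) (hp : p ∈ (Nat.nth Nat.Prime t).primesBelow) : p.Prime :=
    Nat.prime_of_mem_primesBelow hp
  have hφ := totient_prod_primes hprime
  rw [← firstPrimesProduct_eq_prod_primesBelow] at hφ
  have hn : 1 < firstPrimesProduct t :=
    (Nat.prime_nth_prime 0).one_lt.trans_le (Nat.le_of_dvd (firstPrimesProduct_pos t)
      (Finset.dvd_prod_of_mem _ (Finset.mem_range.2 (by omega))))
  have hn0 : (firstPrimesProduct t : ℝ) ≠ 0 := by exact_mod_cast (by omega)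
  have hratio : (firstPrimesProduct t : ℝ) / (firstPrimesProduct t).totient ≤
      C * (3 * Real.log t) := by
    rw [hφ, div_mul_cancel_left₀ hn0]
    refine hP.trans (mul_le_mul_of_nonneg_left ?_ hC.le)
    have hcube : (Nat.nth Nat.Prime t : ℝ) ≤ (t : ℝ) ^ 3 := by exact_mod_cast nth_prime_le_cube ht
    have := Real.log_le_log (by exact_mod_cast (Nat.prime_nth_prime t).pos) hcube
    rw [Real.log_pow] at this
    exact_mod_cast this
  have hlog1 : 1 ≤ Real.log t := by
    rw [Real.le_log_iff_exp_le (by linarith)]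
    linarith [Real.exp_one_lt_d9]
  have hbound := dominationNumber_unitaryCayleyGraph_le hn
  have hmul := mul_le_mul hratio (log_firstPrimesProduct_le ht)
    (Real.log_natCast_nonneg _) (by positivity)
  have hone : 1 ≤ (t : ℝ) * Real.log t ^ 2 :=
    one_le_mul_of_one_le_of_one_le (by linarith) (one_le_pow₀ hlog1)
  calc _ ≤ _ := hbound
    _ ≤ C * (3 * Real.log t) * (3 * t * Real.log t) + t * Real.log t ^ 2 := add_le_add hmul hone
    _ = _ := by ring

theorem mainTheorem7 :
    ∃ C₁ C₂ : ℝ, 0 < C₁ ∧ 0 < C₂ ∧ ∃ t₀ : ℕ, ∀ t : ℕ, t₀ ≤ t →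
      C₁ * (t : ℝ) * Real.log (t : ℝ) ≤
          (dominationNumber (unitaryCayleyGraph (ZMod (firstPrimesProduct t))) : ℝ) ∧
        (dominationNumber (unitaryCayleyGraph (ZMod (firstPrimesProduct t))) : ℝ) ≤
          C₂ * (t : ℝ) * Real.log (t : ℝ) ^ 2 := by
  obtain ⟨C, hC, hupper⟩ := exists_dominationNumber_le_mul_log_sq
  obtain ⟨t₁, ht₁⟩ := Filter.eventually_atTop.1 hupper
  exact ⟨1 / 8, C, by norm_num, hC, max 4 t₁, fun t ht ↦
    ⟨mul_log_le_dominationNumber ((le_max_left _ _).trans ht),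
      ht₁ t ((le_max_right _ _).trans ht)⟩⟩
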